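/- For a prime $p$, integers $n,\alpha,k\ge 0$ and $r\in\mathbb Z$, let $$T^p_{k,\alpha}(n,r):=\frac{k!\,p^k}{[n/p^{\alpha-1}]!}\sum_{i\in\mathbb Z}(-1)^{p^\alpha i+r}\binom n{p^\alpha i+r}\binom ik ,$$ where $[\cdot]$ denotes the integer part (floor), $\binom nm=0$ unless $0\le m\le n$, and $\binom ik=i(i-1)\cdots(i-k+1)/k!$ for every integer $i$. For an integer $x$ let $\overline x\in\{0,\dots,p-1\}$ denote its residue mod $p$. Theorem. Let $p$ be any prime and $\alpha\ge 1$. For all integers $n,k\ge 0$ and all $r\in\mathbb Z$, the rational numbers $T^p_{k,\alpha+1}(n,r)$ and $T^p_{k,\alpha}([n/p],[r/p])$ are $p$-integral (their denominators are prime to $p$), and $$T^p_{k,\alpha+1}(n,r)\equiv(-1)^{\overline r}\binom{\overline n}{\overline r}\,T^p_{k,\alpha}\bigl([n/p],[r/p]\bigr)\pmod p$$ as a congruence in the ring $\mathbb Z_{(p)}$ of $p$-integral rational numbers. -/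

import Mathlib

/-- The binomial coefficient `n` over `m` for a natural number `n` and an integer `m`;
it is `0` if `m < 0` or `m > n`. -/
def intChoose (n : ℕ) (m : ℤ) : ℕ :=
  if 0 ≤ m then n.choose m.toNat else 0

theorem intChoose_ne_zero {n : ℕ} {m : ℤ} (h : intChoose n m ≠ 0) : 0 ≤ m ∧ m ≤ n := by
  unfold intChoose at h
  split_ifs at h with h0
  · refine ⟨h0, ?_⟩
    by_contra hlt
    exact h (Nat.choose_eq_zero_of_lt (by omega))
  · exact absurd rfl h

/-- The summand with index `i` in the sum that defines `T`. The lower argument `p ^ α * i + r` may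
be any integer; `Ring.choose i k` is `i (i - 1) ⋯ (i - k + 1) / k!`, also for negative `i`. -/
def TSummand (p k α n : ℕ) (r i : ℤ) : ℚ :=
  (-1 : ℚ) ^ ((p : ℤ) ^ α * i + r) * (intChoose n ((p : ℤ) ^ α * i + r) : ℚ)
    * ((Ring.choose i k : ℤ) : ℚ)

/-- Only finitely many summands are nonzero, so the `finsum` below is the actual sum. -/
theorem TSummand_support_finite {p : ℕ} (hp : 0 < p) (k α n : ℕ) (r : ℤ) :
    (Function.support (TSummand p k α n r)).Finite := by
  have hq : (0 : ℤ) < (p : ℤ) ^ α := by positivity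
  refine Set.Finite.of_finite_image (f := fun i : ℤ => (p : ℤ) ^ α * i + r)
    ((Set.finite_Icc (0 : ℤ) n).subset ?_) ?_
  · rintro _ ⟨i, hi, rfl⟩
    refine intChoose_ne_zero (n := n) ?_
    intro h0
    exact hi (by simp only [TSummand, h0, Nat.cast_zero, mul_zero, zero_mul])
  · intro a _ b _ hab
    have : (p : ℤ) ^ α * a = (p : ℤ) ^ α * b := by simpa using hab
    exact mul_left_cancel₀ hq.ne' this

/-- The rational number `T` with parameters `p`, `k`, `α`, at `(n, r)`: the factor
`k! p ^ k / [n / p ^ (α - 1)]!` times the sum over all integers `i` of the terms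
`(-1) ^ (p ^ α i + r) (n choose p ^ α i + r) (i choose k)`.
The integer part of `n / p ^ (α - 1)` is written as that of `n p / p ^ α`, which is also
right for `α = 0`. -/
noncomputable def T (p k α n : ℕ) (r : ℤ) : ℚ :=
  ((k.factorial : ℚ) * (p : ℚ) ^ k / ((n * p / p ^ α).factorial : ℚ))
    * ∑ᶠ i : ℤ, TSummand p k α n r i

/-- `x` lies in the local ring of rational numbers with denominator prime to the prime `p`. -/
def IsPIntegral (p : ℕ) (x : ℚ) : Prop := ¬ p ∣ x.den

/-- Congruence modulo `p` of two `p`-integral rational numbers: both are `p`-integral and their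
difference is `p` times a `p`-integral number. -/
def PCongr (p : ℕ) (x y : ℚ) : Prop :=
  IsPIntegral p x ∧ IsPIntegral p y ∧ ∃ z : ℚ, IsPIntegral p z ∧ x - y = (p : ℚ) * z

/-!
The sum in `T p k α n r` is the value at `(1 - X) ^ n` of the linear functional `residueSum` on
`ℤ[X]` that sends `X ^ j` to `choose ((j - r) / p ^ α) k` if `p ^ α ∣ j - r` and to `0` otherwise.
Write `n = p m + n₀` with `n₀ < p`, and `(1 - X) ^ p = (1 - X ^ p) + p u` with `u ∈ ℤ[X]`. Then
`(1 - X) ^ n` is the sum over `s` of `C(m, s) p ^ s (1 - X) ^ n₀ u ^ s (1 - X ^ p) ^ (m - s)`.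

The functional for `p ^ (α + 1)`, applied to `X ^ a g(X ^ p)`, is a functional for `p ^ α` applied
to `g`, or `0` (`residueSum_X_pow_mul_expand`). Hence the term `s = 0` gives precisely the
right-hand side of the congruence: since `n₀ < p`, only the coefficient of `(1 - X) ^ n₀` at the
residue of `r` enters (`residueSum_one_sub_X_pow_mod_mul_expand`). The terms with `s ≥ 1` are
integer combinations of the values `T p k α (m - s) r'`, with coefficients that are multiples of
`p ^ s C(m, s) [(m - s) / p ^ (α - 1)]! / [m / p ^ (α - 1)]!`. This number is `p ^ s / s!` times an
integer, hence divisible by `p` in `ℤ_(p)`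
(`pow_mul_choose_mul_factorial_div_mem_pIntegers`).

So the congruence follows from the `p`-integrality of `T` for the smaller parameter, and it gives
the `p`-integrality for the next one. The induction starts at `α = 1` (`T_one_mem_pIntegers`):
there `T` is `1 / n!` times an alternating binomial sum of the function `j ↦ F(j - r)` cut
off to `j ≡ r` mod `p`, where `F ∈ ℤ[X]`. By Euler's theorem, the indicator function of `p ℤ` is
congruent to `1 - x ^ φ(p ^ M)` modulo any `p ^ M`, so the cut-off function may be replaced by an
integer polynomial, whose `n`-th difference is divisible by `n!`.
-/

open Polynomial

/-! ### `p`-integral rational numbers -/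

/-- A rational number is `p`-integral as soon as some denominator of it is prime to `p`. -/
theorem isPIntegral_of_mul_eq {p : ℕ} {x : ℚ} {d a : ℤ} (hd : ¬ (p : ℤ) ∣ d)
    (h : x * d = a) : IsPIntegral p x := by
  have hd0 : (d : ℚ) ≠ 0 := by
    rintro h0
    exact hd (by simp [Int.cast_eq_zero.mp h0])
  rw [← eq_div_iff hd0] at h
  intro hx
  rw [h, ← Rat.divInt_eq_div] at hx
  exact hd ((Int.natCast_dvd_natCast.mpr hx).trans (Rat.den_dvd a d))

theorem isPIntegral_intCast {p : ℕ} (hp : p.Prime) (a : ℤ) : IsPIntegral p a := by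
  simpa [IsPIntegral] using hp.one_lt.ne'

/-- The local ring `ℤ_(p)` of `p`-integral rational numbers. -/
def pIntegers {p : ℕ} (hp : p.Prime) : Subring ℚ where
  carrier := {x | IsPIntegral p x}
  zero_mem' := by simpa using isPIntegral_intCast hp 0
  one_mem' := by simpa using isPIntegral_intCast hp 1
  add_mem' {x y} hx hy h := by
    rcases hp.dvd_mul.mp (h.trans (Rat.add_den_dvd x y)) with h | h
    exacts [hx h, hy h]
  mul_mem' {x y} hx hy h := by
    rcases hp.dvd_mul.mp (h.trans (Rat.mul_den_dvd x y)) with h | h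
    exacts [hx h, hy h]
  neg_mem' {x} hx := by simpa [IsPIntegral] using hx

/-- It suffices that the numerator is divisible by the power of `p` in the denominator. -/
theorem div_mem_pIntegers {p : ℕ} (hp : p.Prime) {m : ℕ} (hm : m ≠ 0) {a : ℤ}
    (h : (p : ℤ) ^ padicValNat p m ∣ a) : (a / m : ℚ) ∈ pIntegers hp := by
  have : Fact p.Prime := ⟨hp⟩
  obtain ⟨b, rfl⟩ := h
  obtain ⟨c, hc⟩ : p ^ padicValNat p m ∣ m := pow_padicValNat_dvd
  refine isPIntegral_of_mul_eq (d := c) (a := b) ?_ ?_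
  · rw [Int.natCast_dvd_natCast]
    rintro ⟨e, rfl⟩
    exact pow_succ_padicValNat_not_dvd hm ⟨e, by rw [pow_succ, mul_assoc]; exact hc⟩
  · have hmQ : (m : ℚ) ≠ 0 := by exact_mod_cast hm
    have hcQ : (m : ℚ) = (p : ℚ) ^ padicValNat p m * c := by exact_mod_cast hc
    rw [div_mul_eq_mul_div, div_eq_iff hmQ]
    push_cast
    rw [hcQ]
    ring

/-! ### Divisibility of factorials -/

theorem factorial_div_mul_factorial_dvd (q : ℕ) {a b : ℕ} (h : a ≤ b) :
    (b / q).factorial * a.factorial ∣ b.factorial * (a / q).factorial := by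
  induction b, h using Nat.le_induction with
  | base => rw [mul_comm]
  | succ b _ ih =>
    rw [Nat.succ_div]
    split_ifs with hq
    · have hdvd : b / q + 1 ∣ b + 1 := by
        have := Nat.div_dvd_of_dvd hq
        rwa [Nat.succ_div, if_pos hq] at this
      rw [Nat.factorial_succ, Nat.factorial_succ, mul_assoc, mul_assoc]
      exact mul_dvd_mul hdvd ih
    · rw [Nat.factorial_succ, mul_assoc, add_zero]
      exact ih.mul_left _

/-- Up to the factor `p ^ (s - 1) / s!`, which is `p`-integral by Legendre's formula, the number is
the integer quotient of the falling factorial `m (m - 1) ⋯ (m - s + 1)` by the product of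
the `j` with `(m - s) / q < j ≤ m / q`. -/
theorem pow_mul_choose_mul_factorial_div_mem_pIntegers {p : ℕ} (hp : p.Prime) (q : ℕ) {m s : ℕ}
    (hs : s ≠ 0) (hsm : s ≤ m) :
    ((p : ℚ) ^ (s - 1) * m.choose s * ((m - s) / q).factorial / (m / q).factorial)
      ∈ pIntegers hp := by
  have : Fact p.Prime := ⟨hp⟩
  obtain ⟨c, hc⟩ := factorial_div_mul_factorial_dvd q (Nat.sub_le m s)
  rw [← Nat.choose_mul_factorial_mul_factorial hsm] at hc
  have hc' : m.choose s * s.factorial * ((m - s) / q).factorial = (m / q).factorial * c :=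
    Nat.eq_of_mul_eq_mul_right (Nat.factorial_pos (m - s)) (by linarith)
  have hcQ : (m.choose s : ℚ) * s.factorial * ((m - s) / q).factorial
      = (m / q).factorial * c := by exact_mod_cast hc'
  have hlt := padicValNat_factorial_lt_of_ne_zero p hs
  have key := div_mem_pIntegers hp s.factorial_ne_zero (a := (p : ℤ) ^ (s - 1) * c)
    ((pow_dvd_pow _ (by omega)).mul_right _)
  convert key using 1
  have h1 : (s.factorial : ℚ) ≠ 0 := by exact_mod_cast s.factorial_ne_zero
  have h2 : ((m / q).factorial : ℚ) ≠ 0 := by exact_mod_cast (m / q).factorial_ne_zero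
  rw [div_eq_div_iff h2 h1]
  push_cast
  linear_combination (p : ℚ) ^ (s - 1) * hcQ

/-! ### Alternating binomial sums of integer polynomials -/

/-- The `n`-th difference of an integer polynomial is divisible by `n!`. -/
theorem factorial_dvd_sum_neg_one_pow_mul_choose_mul_eval (n : ℕ) (H : ℤ[X]) :
    (n.factorial : ℤ) ∣
      ∑ j ∈ Finset.range (n + 1), (-1) ^ j * (n.choose j : ℤ) * H.eval (j : ℤ) := by
  induction n generalizing H with
  | zero => simp
  | succ n ih =>
    -- Write `H = X * H₁ + c`. The constant `c` contributes `0`, and the factor `j` of `X * H₁` is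
    -- absorbed by `(j + 1) C(n + 1, j + 1) = (n + 1) C(n, j)`.
    have h0 : ∑ j ∈ Finset.range (n + 1 + 1),
        (-1) ^ j * ((n + 1).choose j : ℤ) * H.eval (j : ℤ)
        = -((n + 1 : ℕ) : ℤ) * ∑ j ∈ Finset.range (n + 1),
          (-1) ^ j * (n.choose j : ℤ) * (H.divX.comp (X + 1)).eval (j : ℤ) := by
      have hH : ∀ x : ℤ, H.eval x = H.divX.eval x * x + H.coeff 0 := fun x => by
        conv_lhs => rw [← H.divX_mul_X_add]
        simp
      have hc : ∑ j ∈ Finset.range (n + 1 + 1), (-1) ^ j * ((n + 1).choose j : ℤ) = 0 :=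
        Int.alternating_sum_range_choose_of_ne n.succ_ne_zero
      simp_rw [hH, mul_add, Finset.sum_add_distrib, ← Finset.sum_mul, hc, zero_mul, add_zero]
      rw [Finset.sum_range_succ', Finset.mul_sum]
      simp only [Nat.cast_zero, mul_zero, add_zero]
      refine Finset.sum_congr rfl fun j _ => ?_
      have hch : ((n + 1 : ℕ) : ℤ) * (n.choose j : ℤ)
          = (n + 1).choose (j + 1) * ((j + 1 : ℕ) : ℤ) := by
        exact_mod_cast Nat.add_one_mul_choose_eq n j
      simp only [eval_comp, eval_add, eval_X, eval_one]
      push_cast at hch ⊢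
      linear_combination (-1) ^ j * H.divX.eval ((j : ℤ) + 1) * hch
    rw [h0, Nat.factorial_succ, Nat.cast_mul, neg_mul, dvd_neg]
    exact mul_dvd_mul_left _ (ih _)

/-- Modulo `p ^ M` the indicator function of `p ℤ` is an integer polynomial, by Euler's theorem. -/
theorem prime_pow_dvd_indicator_sub {p : ℕ} (hp : p.Prime) (M : ℕ) (x : ℤ) :
    (p : ℤ) ^ M ∣ (if (p : ℤ) ∣ x then 1 else 0) - (1 - x ^ (p ^ M).totient) := by
  split_ifs with hx
  · have hM : M ≤ (p ^ M).totient := by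
      rcases M with _ | M
      · simp
      · rw [Nat.totient_prime_pow_succ hp]
        have := Nat.lt_pow_self hp.one_lt (n := M)
        have := hp.two_le
        nlinarith [Nat.le_mul_of_pos_right (p ^ M) (show 0 < p - 1 by omega)]
    rw [sub_sub_cancel]
    exact (pow_dvd_pow _ hM).trans (pow_dvd_pow_of_dvd hx _)
  · have hcop : IsCoprime x ((p ^ M : ℕ) : ℤ) := by
      push_cast
      exact (((Nat.prime_iff_prime_int.mp hp).coprime_iff_not_dvd.mpr hx).symm).pow_right
    obtain ⟨u, hu⟩ := (ZMod.coe_int_isUnit_iff_isCoprime x (p ^ M)).mpr hcop.symm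
    have h1 := congrArg Units.val (ZMod.pow_totient u)
    have : ((p ^ M : ℕ) : ℤ) ∣ 0 - (1 - x ^ (p ^ M).totient) := by
      rw [← ZMod.intCast_zmod_eq_zero_iff_dvd]
      push_cast at h1 ⊢
      rw [← hu, h1]
      simp
    exact_mod_cast this

/-! ### Weighted sums of coefficients over a residue class -/

/-- The weight that `T` puts on the exponent `j`: it is `choose i k` if `j = q * i + r`, and `0` if
`j` is not congruent to `r` modulo `q`. -/
noncomputable def residueWeight (q : ℤ) (k : ℕ) (r j : ℤ) : ℤ :=
  if q ∣ j - r then Ring.choose ((j - r) / q) k else 0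

/-- The linear functional on `ℤ[X]` with value `residueWeight q k r j` at `X ^ j`. -/
noncomputable def residueSum (q : ℤ) (k : ℕ) (r : ℤ) : ℤ[X] →ₗ[ℤ] ℤ :=
  Polynomial.lsum fun j => residueWeight q k r j • LinearMap.id

theorem residueSum_monomial (q : ℤ) (k : ℕ) (r : ℤ) (j : ℕ) (a : ℤ) :
    residueSum q k r (monomial j a) = a * residueWeight q k r j := by
  simp [residueSum, Polynomial.lsum, mul_comm]

theorem one_sub_X_pow_eq_sum_monomial (n : ℕ) :
    (1 - X : ℤ[X]) ^ n = ∑ j ∈ Finset.range (n + 1), monomial j ((-1) ^ j * (n.choose j : ℤ)) := by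
  rw [sub_eq_neg_add, add_pow]
  refine Finset.sum_congr rfl fun j _ => ?_
  rw [← C_mul_X_pow_eq_monomial, neg_pow]
  simp
  ring

theorem residueSum_one_sub_X_pow (q : ℤ) (k : ℕ) (r : ℤ) (n : ℕ) :
    residueSum q k r ((1 - X) ^ n)
      = ∑ j ∈ Finset.range (n + 1), (-1) ^ j * (n.choose j : ℤ) * residueWeight q k r j := by
  simp_rw [one_sub_X_pow_eq_sum_monomial, map_sum, residueSum_monomial]

theorem residueWeight_mul_add {p : ℤ} (hp : 0 < p) {q : ℤ} (k : ℕ) (r a j : ℤ) :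
    residueWeight (p * q) k r (a + p * j)
      = if p ∣ r - a then residueWeight q k ((r - a) / p) j else 0 := by
  unfold residueWeight
  by_cases h : p ∣ r - a
  · obtain ⟨b, hb⟩ := h
    have hj : a + p * j - r = p * (j - b) := by linear_combination -hb
    simp only [hb, hj, dvd_mul_right, if_true, mul_dvd_mul_iff_left hp.ne',
      Int.mul_ediv_cancel_left _ hp.ne', Int.mul_ediv_mul_of_pos _ _ hp]
  · rw [if_neg, if_neg h]
    intro h1
    rw [show r - a = p * j - (a + p * j - r) by ring] at h
    exact h ((dvd_mul_right p j).sub ((dvd_mul_right p q).trans h1))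

/-- Substituting `X ^ p` for `X` and shifting exponents reduces the modulus from `p q` to `q`. -/
theorem residueSum_X_pow_mul_expand {p : ℕ} (hp : 0 < p) (q : ℤ) (k : ℕ) (r : ℤ) (a : ℕ)
    (g : ℤ[X]) :
    residueSum (p * q) k r (X ^ a * expand ℤ p g)
      = if (p : ℤ) ∣ r - a then residueSum q k ((r - a) / p) g else 0 := by
  induction g using Polynomial.induction_on' with
  | add f g hf hg =>
    rw [map_add, mul_add, map_add, hf, hg]
    split_ifs <;> simp
  | monomial j c =>
    rw [expand_monomial, X_pow_mul_monomial, residueSum_monomial, residueSum_monomial]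
    have := residueWeight_mul_add (p := p) (q := q) (by exact_mod_cast hp) k r a j
    rw [show ((j * p + a : ℕ) : ℤ) = a + p * j by push_cast; ring, this]
    split_ifs <;> simp

/-! ### `T` as a value of such a functional -/

theorem finsum_TSummand {p : ℕ} (hp : 0 < p) (k α n : ℕ) (r : ℤ) :
    ∑ᶠ i : ℤ, TSummand p k α n r i = (residueSum ((p : ℤ) ^ α) k r ((1 - X) ^ n) : ℤ) := by
  have hq : (p : ℤ) ^ α ≠ 0 := by positivity
  let G : ℤ → ℚ := fun j =>
    (-1) ^ j * (intChoose n j : ℚ) * (residueWeight ((p : ℤ) ^ α) k r j : ℤ)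
  have hG : ∀ i, TSummand p k α n r i = G ((p : ℤ) ^ α * i + r) := fun i => by
    simp [G, TSummand, residueWeight, hq]
  have hinj : Function.Injective fun i : ℤ => (p : ℤ) ^ α * i + r := fun a b hab =>
    mul_left_cancel₀ hq (add_right_cancel hab)
  -- Both the sum over `i` and the sum over exponents `j : ℕ` are the sum of `G` over `ℤ`.
  have h1 : ∑ᶠ i : ℤ, G ((p : ℤ) ^ α * i + r) = ∑ᶠ j : ℤ, G j := by
    rw [← finsum_mem_univ G, ← finsum_mem_range hinj]
    refine finsum_mem_inter_support_eq' G _ _ fun j hj => ⟨fun _ => trivial, fun _ => ?_⟩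
    have hw : (p : ℤ) ^ α ∣ j - r := by
      by_contra h
      exact hj (by simp [G, residueWeight, h])
    obtain ⟨i, hi⟩ := hw
    exact ⟨i, by simp [← hi]⟩
  have h2 : ∑ᶠ j : ℕ, G j = ∑ᶠ j : ℤ, G j := by
    rw [← finsum_mem_univ (fun j : ℤ => G j), ← finsum_mem_range Nat.cast_injective]
    refine finsum_mem_inter_support_eq' G _ _ fun j hj => ⟨fun _ => trivial, fun _ => ?_⟩
    have h0 : 0 ≤ j := by
      by_contra h
      exact hj (by simp [G, intChoose, h])
    exact ⟨j.toNat, Int.toNat_of_nonneg h0⟩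
  rw [finsum_congr hG, h1, ← h2, finsum_eq_sum_of_support_subset (s := Finset.range (n + 1)),
    residueSum_one_sub_X_pow]
  · push_cast
    refine Finset.sum_congr rfl fun j _ => ?_
    simp [G, intChoose]
  · intro j hj
    rw [Finset.coe_range, Set.mem_Iio]
    by_contra h
    exact hj (by simp [G, intChoose, Nat.choose_eq_zero_of_lt (show n < j by omega)])

/-- Parameter values `α ≥ 1` are written `β + 1`, so that `[n / p ^ (α - 1)] = n / p ^ β`. -/
theorem T_succ {p : ℕ} (hp : 0 < p) (k β n : ℕ) (r : ℤ) :
    T p k (β + 1) n r = (k.factorial : ℚ) * (p : ℚ) ^ k / ((n / p ^ β).factorial : ℚ)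
      * (residueSum ((p : ℤ) ^ (β + 1)) k r ((1 - X) ^ n) : ℤ) := by
  rw [T, finsum_TSummand hp, pow_succ, Nat.mul_div_mul_right _ _ hp]

/-! ### The case `α = 1` -/

/-- Scaling the roots `0, 1, …, k - 1` of the falling factorial by `p` gives the polynomial. -/
theorem exists_eval_eq_factorial_mul_pow_mul_choose (p k : ℕ) :
    ∃ F : ℤ[X], ∀ i : ℤ, F.eval ((p : ℤ) * i) = k.factorial * (p : ℤ) ^ k * Ring.choose i k := by
  refine ⟨(descPochhammer ℤ k).scaleRoots p, fun i => ?_⟩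
  have h := scaleRoots_eval₂_mul (p := descPochhammer ℤ k) (RingHom.id ℤ) i (p : ℤ)
  have hc := Ring.descPochhammer_eq_factorial_smul_choose i k
  rw [← eval_eq_smeval, nsmul_eq_mul] at hc
  rw [descPochhammer_natDegree] at h
  simp only [RingHom.id_apply, eval₂_id] at h
  rw [h, hc]
  ring

/-- With `F` from `exists_eval_eq_factorial_mul_pow_mul_choose`, `k! p ^ k` times the weight at `j`
is `F (j - r)` times the indicator function of `p ∣ j - r`. Modulo the power of `p` in `n!` this is an integer polynomial
in `j`, so its `n`-th difference is divisible by that power. -/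
theorem T_one_mem_pIntegers {p : ℕ} (hp : p.Prime) (k n : ℕ) (r : ℤ) :
    T p k 1 n r ∈ pIntegers hp := by
  have : Fact p.Prime := ⟨hp⟩
  obtain ⟨F, hF⟩ := exists_eval_eq_factorial_mul_pow_mul_choose p k
  set M := padicValNat p n.factorial with hM
  let H : ℤ[X] := ((1 - X ^ (p ^ M).totient) * F).comp (X - C r)
  have hw : ∀ j : ℕ, (p : ℤ) ^ M ∣
      k.factorial * (p : ℤ) ^ k * residueWeight p k r j - H.eval (j : ℤ) := fun j => by
    have hval : k.factorial * (p : ℤ) ^ k * residueWeight p k r j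
        = (if (p : ℤ) ∣ j - r then 1 else 0) * F.eval (j - r) := by
      unfold residueWeight
      split_ifs with h
      · rw [← hF, Int.mul_ediv_cancel' h, one_mul]
      · simp
    have := (prime_pow_dvd_indicator_sub hp M (j - r)).mul_right (F.eval ((j : ℤ) - r))
    rw [hval]
    simpa [H, sub_mul] using this
  have hdvd : (p : ℤ) ^ M ∣ k.factorial * (p : ℤ) ^ k * residueSum p k r ((1 - X) ^ n) := by
    have h1 : (p : ℤ) ^ M ∣ n.factorial := by
      exact_mod_cast (pow_padicValNat_dvd : p ^ M ∣ n.factorial)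
    rw [← dvd_sub_left (h1.trans (factorial_dvd_sum_neg_one_pow_mul_choose_mul_eval n H)),
      residueSum_one_sub_X_pow, Finset.mul_sum, ← Finset.sum_sub_distrib]
    refine Finset.dvd_sum fun j _ => ?_
    convert (hw j).mul_left ((-1) ^ j * (n.choose j : ℤ)) using 1
    ring
  have := div_mem_pIntegers hp n.factorial_ne_zero hdvd
  rw [T_succ hp.pos k 0]
  convert this using 1
  simp
  ring

/-! ### Passing from `α` to `α + 1` -/

theorem exists_one_sub_X_pow_prime_eq {p : ℕ} (hp : p.Prime) :
    ∃ u : ℤ[X], (1 - X : ℤ[X]) ^ p = (1 - X ^ p) + C (p : ℤ) * u := by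
  obtain ⟨v, hv⟩ := exists_add_pow_prime_eq hp (1 : ℤ[X]) (-X)
  rw [sub_eq_add_neg, hv, one_pow]
  rcases hp.eq_two_or_odd' with rfl | hodd
  · exact ⟨X ^ 2 - X * v, by simp; ring⟩
  · exact ⟨-X * v, by rw [hodd.neg_pow]; simp; ring⟩

/-- The part of `(1 - X) ^ n` that survives modulo `p` contributes exactly the right-hand side: of
the factor `(1 - X) ^ (n % p)` only the monomial with exponent congruent to `r` counts. -/
theorem residueSum_one_sub_X_pow_mod_mul_expand {p : ℕ} (hp : 0 < p) (q : ℤ) (k n : ℕ) (r : ℤ)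
    (g : ℤ[X]) :
    residueSum (p * q) k r ((1 - X) ^ (n % p) * expand ℤ p g)
      = (-1) ^ (r % (p : ℤ)).toNat * ((n % p).choose (r % (p : ℤ)).toNat : ℤ)
        * residueSum q k (r / p) g := by
  have hpZ : (0 : ℤ) < p := by exact_mod_cast hp
  obtain ⟨a, ha⟩ := Int.eq_ofNat_of_zero_le (Int.emod_nonneg r hpZ.ne')
  have hap : a < p := by exact_mod_cast ha ▸ Int.emod_lt_of_pos r hpZ
  have hra : r - a = p * (r / p) := by
    rw [← ha]; linarith [Int.emod_add_mul_ediv r p]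
  have hn : n % p < p := Nat.mod_lt _ hp
  rw [one_sub_X_pow_eq_sum_monomial, Finset.sum_mul, map_sum, ha, Int.toNat_natCast]
  have hterm : ∀ (b : ℕ) (c : ℤ), residueSum (p * q) k r (monomial b c * expand ℤ p g)
      = c * if (p : ℤ) ∣ r - b then residueSum q k ((r - b) / p) g else 0 := fun b c => by
    rw [← residueSum_X_pow_mul_expand hp, ← C_mul_X_pow_eq_monomial, mul_assoc, ← smul_eq_C_mul,
      map_smul, smul_eq_mul]
  simp_rw [hterm]
  rw [Finset.sum_eq_single a]
  · rw [if_pos ⟨_, hra⟩, hra, Int.mul_ediv_cancel_left _ hpZ.ne']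
  · intro b hb hba
    rw [if_neg, mul_zero]
    intro h
    have h2 : (p : ℤ) ∣ (b : ℤ) - a := by
      have := (Dvd.intro _ hra.symm).sub h
      simpa using this
    have hb' := Finset.mem_range.mp hb
    have := Int.eq_zero_of_abs_lt_dvd h2 (by rw [abs_lt]; omega)
    omega
  · intro h
    rw [Nat.choose_eq_zero_of_lt (by simpa using h)]
    simp

/-- If the `T` with parameter `β + 1` are `p`-integral, then every term of the expansion of
`((1 - X ^ p) + p u) ^ m` with `s ≥ 1` factors `p u` contributes a multiple of `p`. -/
theorem factorial_div_mul_residueSum_mem_pIntegers {p : ℕ} (hp : p.Prime) {k β : ℕ}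
    (hT : ∀ n r, T p k (β + 1) n r ∈ pIntegers hp) {m s : ℕ} (hs : s ≠ 0) (hsm : s ≤ m) (r : ℤ)
    (g : ℤ[X]) :
    (k.factorial : ℚ) * (p : ℚ) ^ k / ((m / p ^ β).factorial : ℚ)
        * ((p : ℚ) ^ (s - 1) * m.choose s
          * (residueSum (p * p ^ (β + 1)) k r (g * (1 - X ^ p) ^ (m - s)) : ℤ))
      ∈ pIntegers hp := by
  induction g using Polynomial.induction_on' with
  | add f g hf hg =>
    convert add_mem hf hg using 1
    rw [add_mul, map_add]
    push_cast
    ring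
  | monomial a c =>
    have hexp : (1 - X ^ p : ℤ[X]) ^ (m - s) = expand ℤ p ((1 - X) ^ (m - s)) := by simp
    rw [hexp, ← C_mul_X_pow_eq_monomial, mul_assoc (C c) (X ^ a), ← smul_eq_C_mul (p := X ^ a * _),
      map_smul, smul_eq_mul, residueSum_X_pow_mul_expand hp.pos]
    split_ifs with h
    · have h1 := mul_mem (mul_mem (intCast_mem (pIntegers hp) c)
        (pow_mul_choose_mul_factorial_div_mem_pIntegers hp (p ^ β) hs hsm))
        (hT (m - s) ((r - a) / p))
      rw [T_succ hp.pos] at h1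
      convert h1 using 1
      have : (((m - s) / p ^ β).factorial : ℚ) ≠ 0 := by
        exact_mod_cast Nat.factorial_ne_zero _
      field_simp
      push_cast
      ring
    · simp

/-- The binomial expansion of `(1 - X) ^ (n % p) ((1 - X ^ p) + p u) ^ (n / p)`, with the term free
of `p` split off. -/
theorem one_sub_X_pow_eq_sum_add {p : ℕ} {u : ℤ[X]}
    (hu : (1 - X : ℤ[X]) ^ p = (1 - X ^ p) + C (p : ℤ) * u) (n : ℕ) :
    (1 - X : ℤ[X]) ^ n
      = (∑ s ∈ Finset.range (n / p), C ((p : ℤ) ^ (s + 1) * (n / p).choose (s + 1)) *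
          ((1 - X) ^ (n % p) * u ^ (s + 1) * (1 - X ^ p) ^ (n / p - (s + 1))))
        + (1 - X) ^ (n % p) * expand ℤ p ((1 - X) ^ (n / p)) := by
  have hpow : (1 - X : ℤ[X]) ^ n
      = (1 - X) ^ (n % p) * (C (p : ℤ) * u + (1 - X ^ p)) ^ (n / p) := by
    rw [add_comm, ← hu, ← pow_mul, ← pow_add, Nat.mod_add_div]
  have hexp : expand ℤ p ((1 - X) ^ (n / p)) = (1 - X ^ p : ℤ[X]) ^ (n / p) := by simp
  rw [hpow, hexp, add_pow, Finset.sum_range_succ', mul_add, Finset.mul_sum]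
  refine congrArg₂ (· + ·) (Finset.sum_congr rfl fun s _ => ?_) (by simp)
  have hch : C ((n / p).choose (s + 1) : ℤ) = ((n / p).choose (s + 1) : ℤ[X]) := by simp
  rw [mul_pow, C_mul, C_pow, hch]
  ring

/-- The congruence, conditional on the `p`-integrality of `T` with the smaller parameter. -/
theorem exists_T_sub_eq_mul {p : ℕ} (hp : p.Prime) {k β : ℕ}
    (hT : ∀ n r, T p k (β + 1) n r ∈ pIntegers hp) (n : ℕ) (r : ℤ) :
    ∃ z ∈ pIntegers hp, T p k (β + 2) n r
      - (-1) ^ (r % (p : ℤ)).toNat * ((n % p).choose (r % (p : ℤ)).toNat : ℚ)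
        * T p k (β + 1) (n / p) (r / p) = p * z := by
  obtain ⟨u, hu⟩ := exists_one_sub_X_pow_prime_eq hp
  obtain ⟨m, hm⟩ : ∃ m, n / p = m := ⟨_, rfl⟩
  obtain ⟨c, hc⟩ : ∃ c : ℚ, c = (k.factorial : ℚ) * (p : ℚ) ^ k / ((m / p ^ β).factorial : ℚ) :=
    ⟨_, rfl⟩
  refine ⟨∑ s ∈ Finset.range m, c * ((p : ℚ) ^ (s + 1 - 1) * m.choose (s + 1)
    * (residueSum (p * p ^ (β + 1)) k r
      ((1 - X) ^ (n % p) * u ^ (s + 1) * (1 - X ^ p) ^ (m - (s + 1))) : ℤ)),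
    sum_mem fun s hs => hc ▸ factorial_div_mul_residueSum_mem_pIntegers hp hT s.succ_ne_zero
      (Finset.mem_range.mp hs) r _, ?_⟩
  have hexpand := one_sub_X_pow_eq_sum_add hu n
  have hS : residueSum (p ^ (β + 2)) k r ((1 - X) ^ n)
      = ∑ s ∈ Finset.range m, (p : ℤ) ^ (s + 1) * m.choose (s + 1) * residueSum (p * p ^ (β + 1)) k r
          ((1 - X) ^ (n % p) * u ^ (s + 1) * (1 - X ^ p) ^ (m - (s + 1)))
        + (-1) ^ (r % (p : ℤ)).toNat * ((n % p).choose (r % (p : ℤ)).toNat : ℤ)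
          * residueSum (p ^ (β + 1)) k (r / p) ((1 - X) ^ m) := by
    rw [pow_succ' (p : ℤ) (β + 1), hexpand, map_add,
      residueSum_one_sub_X_pow_mod_mul_expand hp.pos, map_sum]
    simp_rw [← smul_eq_C_mul, map_smul, smul_eq_mul, hm]
  rw [T_succ hp.pos, T_succ hp.pos, hS,
    show n / p ^ (β + 1) = m / p ^ β by rw [← hm, Nat.div_div_eq_div_mul, pow_succ'], hm, ← hc]
  push_cast
  rw [mul_add, Finset.mul_sum, Finset.mul_sum, sub_eq_iff_eq_add]
  congr 1
  · refine Finset.sum_congr rfl fun s _ => ?_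
    rw [pow_succ]
    ring
  · ring

theorem T_succ_mem_pIntegers {p : ℕ} (hp : p.Prime) (k β n : ℕ) (r : ℤ) :
    T p k (β + 1) n r ∈ pIntegers hp := by
  induction β generalizing n r with
  | zero => exact T_one_mem_pIntegers hp k n r
  | succ β ih =>
    obtain ⟨z, hz, h⟩ := exists_T_sub_eq_mul hp ih n r
    rw [sub_eq_iff_eq_add] at h
    rw [h]
    exact add_mem (mul_mem (natCast_mem _ p) hz)
      (mul_mem (mul_mem (pow_mem (neg_mem (one_mem _)) _) (natCast_mem _ _)) (ih _ _))

theorem mainTheorem4 (p : ℕ) (hp : p.Prime) (α : ℕ) (hα : 1 ≤ α) (k n : ℕ) (r : ℤ) :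
    IsPIntegral p (T p k α (n / p) (r / (p : ℤ))) ∧
    PCongr p (T p k (α + 1) n r)
      ((-1 : ℚ) ^ (r % (p : ℤ)).toNat * ((n % p).choose (r % (p : ℤ)).toNat : ℚ)
        * T p k α (n / p) (r / (p : ℤ))) := by
  obtain ⟨β, rfl⟩ := Nat.exists_eq_add_of_le' hα
  have hT := T_succ_mem_pIntegers hp k β (n / p) (r / p)
  exact ⟨hT, T_succ_mem_pIntegers hp k (β + 1) n r,
    mul_mem (mul_mem (pow_mem (neg_mem (one_mem (pIntegers hp))) _) (natCast_mem _ _)) hT,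
    exists_T_sub_eq_mul hp (T_succ_mem_pIntegers hp k β) n r⟩
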